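/- For a real matrix $Y\in\mathbb R^{n\times m}$ let $$\gamma_2(Y)=\min_{UV^{*}=Y}\ \max_{i}\|u_i\|_2\ \max_{j}\|v_j\|_2 ,$$ the minimum being over all factorizations $Y=UV^{*}$ with real $U\in\mathbb R^{n\times k}$, $V\in\mathbb R^{m\times k}$ ($k$ arbitrary), where $u_i$, $v_j$ are the rows of $U$, $V$. Let $\|\cdot\|_F$ be the Frobenius norm. Let $K_G$ be the real Grothendieck constant, i.e. the least constant $K$ such that for every real matrix $(M_{ij})$ with $\bigl|\sum_{i,j}M_{ij}s_it_j\bigr|\le 1$ for all signs $s_i,t_j\in\{-1,1\}$ one has $\bigl|\sum_{i,j}M_{ij}\langle x_i,y_j\rangle\bigr|\le K$ for all vectors $x_i,y_j$ in the unit ball of a finite-dimensional Euclidean space. **Theorem.** The constant $K_G$ exists (the set of admissible $K$ is non-empty and has a least element), and $c:=4K_G\le 7.13$. Let $d_1,d_2\ge 1$, and let $G$ be a simple bipartite graph with parts $V_1=[n]$ and $V_2=[m]$ in which every vertex of $V_1$ has degree $d_1$ and every vertex of $V_2$ has degree $d_2$, other than the single edge ($n=m=1$). Let $E\subset[n]\times[m]$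 be its edge set, and let $\eta$ be a real number with $\lambda_2\le\eta$, where $\lambda_2$ is the second largest eigenvalue (with multiplicity) of the adjacency matrix of $G$; in particular $\eta=\lambda_2$ is allowed. Then for every $Y\in\mathbb R^{n\times m}$ and every solution $\hat Y$ of the problem $$\text{minimize } \gamma_2(X)\quad\text{subject to } X_{ij}=Y_{ij}\ \text{ for all } (i,j)\in E ,$$ we have $$\frac1{nm}\,\|\hat Y-Y\|_F^2\ \le\ c\,\gamma_2(Y)^2\,\frac{\eta}{\sqrt{d_1d_2}} .$$ -/

import Mathlib

attribute [local instance] Matrix.frobeniusNormedAddCommGroup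

namespace MatrixCompletion

/-- The `ℓ₂ → ℓ_∞` norm of a real matrix: the largest Euclidean norm of a row. -/
noncomputable def maxRowNorm {n k : ℕ} (U : Matrix (Fin n) (Fin k) ℝ) : ℝ :=
  ⨆ i : Fin n, Real.sqrt (∑ j : Fin k, U i j ^ 2)

/-- The factorization norm `γ₂(Y)`: the least value of
`‖U‖_{ℓ₂ → ℓ_∞} ‖V‖_{ℓ₂ → ℓ_∞}` over all factorizations `Y = U Vᵀ`,
with any inner dimension `k`. -/
noncomputable def gammaTwo {n m : ℕ} (Y : Matrix (Fin n) (Fin m) ℝ) : ℝ :=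
  sInf {c : ℝ | ∃ (k : ℕ) (U : Matrix (Fin n) (Fin k) ℝ) (V : Matrix (Fin m) (Fin k) ℝ),
    U * V.transpose = Y ∧ c = maxRowNorm U * maxRowNorm V}

/-- `K` is an admissible constant in the real Grothendieck inequality: whenever a real matrix
`M` satisfies `|∑ M i j * s i * t j| ≤ 1` for all choices of signs `s`, `t`, it satisfies
`|∑ M i j * ⟪u i, v j⟫| ≤ K` for all vectors `u i`, `v j` in the unit ball of a Euclidean space. -/
def GrothendieckInequality (K : ℝ) : Prop :=
  ∀ (p q k : ℕ) (M : Matrix (Fin p) (Fin q) ℝ),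
    (∀ (s : Fin p → ℝ) (t : Fin q → ℝ),
      (∀ i, s i = 1 ∨ s i = -1) → (∀ j, t j = 1 ∨ t j = -1) →
        |∑ i, ∑ j, M i j * (s i * t j)| ≤ 1) →
    ∀ (u : Fin p → EuclideanSpace ℝ (Fin k)) (v : Fin q → EuclideanSpace ℝ (Fin k)),
      (∀ i, ‖u i‖ ≤ 1) → (∀ j, ‖v j‖ ≤ 1) →
        |∑ i, ∑ j, M i j * inner ℝ (u i) (v j)| ≤ K

/-- The real Grothendieck constant `K_G`. -/
noncomputable def grothendieckConstant : ℝ :=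
  sInf {K : ℝ | GrothendieckInequality K}

/-- `G` is a bipartite graph with parts `Fin n` and `Fin m` in which all vertices of the first part
have degree `d₁` and all vertices of the second part have degree `d₂`. -/
structure IsBiregular {n m : ℕ} (G : SimpleGraph (Fin n ⊕ Fin m)) [DecidableRel G.Adj]
    (d₁ d₂ : ℕ) : Prop where
  bipartite : G ≤ completeBipartiteGraph (Fin n) (Fin m)
  degree_left : ∀ i : Fin n, G.degree (Sum.inl i) = d₁
  degree_right : ∀ j : Fin m, G.degree (Sum.inr j) = d₂

/-- The second largest eigenvalue `λ₂`, counted with multiplicity, of the adjacency matrix of a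
graph (`eigenvalues₀` lists the eigenvalues in decreasing order, starting from index `0`).
It is given the value `0` if there are fewer than two vertices. -/
noncomputable def secondEigenvalue {V : Type*} [Fintype V] [DecidableEq V] (G : SimpleGraph V)
    [DecidableRel G.Adj] : ℝ :=
  if h : 1 < Fintype.card V then
    (G.isHermitian_adjMatrix ℝ).eigenvalues₀ ⟨1, h⟩
  else 0

/-- `X` agrees with `Y` on the edges of the bipartite graph `G`. -/
def AgreesOnEdges {n m : ℕ} (G : SimpleGraph (Fin n ⊕ Fin m))
    (X Y : Matrix (Fin n) (Fin m) ℝ) : Prop :=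
  ∀ (i : Fin n) (j : Fin m), G.Adj (Sum.inl i) (Sum.inr j) → X i j = Y i j

/-- `X` is a solution of the matrix completion problem: it minimizes `γ₂` among all matrices that
agree with `Y` on the edges of `G`. -/
def IsCompletion {n m : ℕ} (G : SimpleGraph (Fin n ⊕ Fin m))
    (Y X : Matrix (Fin n) (Fin m) ℝ) : Prop :=
  AgreesOnEdges G X Y ∧
    ∀ Z : Matrix (Fin n) (Fin m) ℝ, AgreesOnEdges G Z Y → gammaTwo X ≤ gammaTwo Z

end MatrixCompletion

/-!
The error `D = Yhat - Y` vanishes on the edges, so its mean square `‖D‖² / (n m)` is the sum of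
`D i j ^ 2` against the discrepancy matrix `J / (n m) - A / |E|`, with `J` the all-ones matrix and
`A` the biadjacency matrix. Three facts bound this sum.

* The sums of the discrepancy matrix against sign vectors are at most `λ₂ / √(d₁ d₂)`: centring the
  sign vectors makes the combined vector orthogonal to the top eigenvector `(√d₁, √d₂)` of the
  adjacency matrix (`IsBiregular.abs_sum_discrepancyMatrix_le`), and on the orthogonal complement of
  that vector the quadratic form is bounded by the second largest eigenvalue
  (`dotProduct_mulVec_le_eigenvalues₀_one`).
* `γ₂` is subadditive and `Yhat` is optimal, so `D` has a factorization with squared row norms close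
  to `2 γ₂(Y)`, and tensor squares of the rows factorize the entrywise square of `D`
  (`exists_factorization_sub_sq`).
* Grothendieck's inequality passes from signs to vectors at the cost of the factor `K_G`.

Grothendieck's inequality holds by Krivine's argument (`grothendieckInequality_krivine`) with the
constant `π / (2 arsinh 1)`. Given unit vectors `u i`, `v j`, there are unit vectors `u' i`, `v' j`
with inner products `sin (arsinh 1 * ⟪u i, v j⟫)`: by the Schur product theorem, the matrix
with these off-diagonal blocks and with `sinh` in place of `sin` in the diagonal blocks is positive
semidefinite (`posSemidef_krivineMatrix`). For a standard Gaussian vector `g`, the expectation of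
`sign ⟪g, u' i⟫ * sign ⟪g, v' j⟫` is `2 / π` times the arcsine of `⟪u' i, v' j⟫`
(`integral_sgn_inner_mul_sgn_inner`), which is proportional to `⟪u i, v j⟫`. Grothendieck's identity
itself is reduced to the plane, where rotation invariance replaces the Gaussian average by an average
over angles.
-/

namespace MatrixCompletion

open MeasureTheory ProbabilityTheory

/-! ### Grothendieck's identity -/

/-- The sign of a real number, with the value `1` at `0`, so that it only takes the values `±1`. -/
noncomputable def sgn (x : ℝ) : ℝ := if 0 ≤ x then 1 else -1

lemma sgn_eq (x : ℝ) : sgn x = 1 ∨ sgn x = -1 := by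
  unfold sgn; split_ifs <;> simp

lemma sgn_of_pos {x : ℝ} (h : 0 < x) : sgn x = 1 := if_pos h.le

lemma sgn_of_neg {x : ℝ} (h : x < 0) : sgn x = -1 := if_neg h.not_ge

lemma sgn_mul_of_pos {r : ℝ} (hr : 0 < r) (x : ℝ) : sgn (r * x) = sgn x := by
  simp [sgn, hr]

@[fun_prop]
lemma measurable_sgn : Measurable sgn :=
  Measurable.ite measurableSet_Ici measurable_const measurable_const

lemma abs_sgn_mul_sgn_le (x y : ℝ) : |sgn x * sgn y| ≤ 1 := by
  rcases sgn_eq x with h | h <;> rcases sgn_eq y with h' | h' <;> simp [h, h']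

lemma intervalIntegrable_sgn_mul_sgn {f g : ℝ → ℝ} (hf : Continuous f) (hg : Continuous g)
    (a b : ℝ) : IntervalIntegrable (fun θ => sgn (f θ) * sgn (g θ)) volume a b := by
  refine (intervalIntegrable_const (c := (1 : ℝ))).mono_fun
    (Measurable.aestronglyMeasurable (by fun_prop)) (Filter.Eventually.of_forall fun θ => ?_)
  simpa using abs_sgn_mul_sgn_le (f θ) (g θ)

lemma integral_sgn_cos_mul_sgn_cos {α : ℝ} (h0 : 0 ≤ α) (hπ : α ≤ Real.pi) :
    ∫ θ in (-(Real.pi / 2))..(-(Real.pi / 2) + 2 * Real.pi),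
      sgn (Real.cos θ) * sgn (Real.cos (θ - α)) = 2 * Real.pi - 4 * α := by
  have hpi := Real.pi_pos
  have hI := intervalIntegrable_sgn_mul_sgn (f := Real.cos) (g := fun θ => Real.cos (θ - α))
    (by fun_prop) (by fun_prop)
  have hneg {x : ℝ} (h1 : Real.pi / 2 < x) (h2 : x < Real.pi + Real.pi / 2) : Real.cos x < 0 :=
    Real.cos_neg_of_pi_div_two_lt_of_lt h1 h2
  have hneg' {x : ℝ} (h1 : -(Real.pi + Real.pi / 2) < x) (h2 : x < -(Real.pi / 2)) :
      Real.cos x < 0 := by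
    rw [← Real.cos_neg]; exact hneg (by linarith) (by linarith)
  have hpos {x : ℝ} (h1 : -(Real.pi / 2) < x) (h2 : x < Real.pi / 2) : 0 < Real.cos x :=
    Real.cos_pos_of_mem_Ioo ⟨h1, h2⟩
  -- The integrand is constant between consecutive zeros of the two cosines.
  have e1 : ∫ θ in (-(Real.pi / 2))..(α - Real.pi / 2),
      sgn (Real.cos θ) * sgn (Real.cos (θ - α)) = -α := by
    rw [intervalIntegral.integral_congr_Ioo_of_le (g := fun _ => (-1 : ℝ)) (by linarith)]
    · simp
    · rintro θ ⟨h1, h2⟩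
      simp only []
      rw [sgn_of_pos (hpos h1 (by linarith)), sgn_of_neg (hneg' (by linarith) (by linarith))]
      norm_num
  have e2 : ∫ θ in (α - Real.pi / 2)..(Real.pi / 2),
      sgn (Real.cos θ) * sgn (Real.cos (θ - α)) = Real.pi - α := by
    rw [intervalIntegral.integral_congr_Ioo_of_le (g := fun _ => (1 : ℝ)) (by linarith)]
    · simp; ring
    · rintro θ ⟨h1, h2⟩
      simp only []
      rw [sgn_of_pos (hpos (by linarith) h2), sgn_of_pos (hpos (by linarith) (by linarith))]
      norm_num
  have e3 : ∫ θ in (Real.pi / 2)..(α + Real.pi / 2),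
      sgn (Real.cos θ) * sgn (Real.cos (θ - α)) = -α := by
    rw [intervalIntegral.integral_congr_Ioo_of_le (g := fun _ => (-1 : ℝ)) (by linarith)]
    · simp
    · rintro θ ⟨h1, h2⟩
      simp only []
      rw [sgn_of_neg (hneg h1 (by linarith)), sgn_of_pos (hpos (by linarith) (by linarith))]
      norm_num
  have e4 : ∫ θ in (α + Real.pi / 2)..(-(Real.pi / 2) + 2 * Real.pi),
      sgn (Real.cos θ) * sgn (Real.cos (θ - α)) = Real.pi - α := by
    rw [intervalIntegral.integral_congr_Ioo_of_le (g := fun _ => (1 : ℝ)) (by linarith)]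
    · simp; ring
    · rintro θ ⟨h1, h2⟩
      simp only []
      rw [sgn_of_neg (hneg (by linarith) (by linarith)),
        sgn_of_neg (hneg (by linarith) (by linarith))]
      norm_num
  rw [← intervalIntegral.integral_add_adjacent_intervals (hI _ (α + Real.pi / 2)) (hI _ _),
    ← intervalIntegral.integral_add_adjacent_intervals (hI _ (Real.pi / 2)) (hI _ _),
    ← intervalIntegral.integral_add_adjacent_intervals (hI _ (α - Real.pi / 2)) (hI _ _),
    e1, e2, e3, e4]
  ring

section Gaussian

variable {E F : Type*} [NormedAddCommGroup E] [InnerProductSpace ℝ E] [FiniteDimensional ℝ E]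
  [MeasurableSpace E] [BorelSpace E] [NormedAddCommGroup F] [InnerProductSpace ℝ F]
  [FiniteDimensional ℝ F] [MeasurableSpace F] [BorelSpace F]

lemma charFunDual_stdGaussian_map_inner_prod (u v : E) (L : StrongDual ℝ (ℝ × ℝ)) :
    charFunDual ((stdGaussian E).map ((innerSL ℝ u).prod (innerSL ℝ v))) L =
      Complex.exp (-((L (1, 0) ^ 2 * ‖u‖ ^ 2 + 2 * (L (1, 0) * L (0, 1) * inner ℝ u v)
        + L (0, 1) ^ 2 * ‖v‖ ^ 2 : ℝ) : ℂ) / 2) := by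
  rw [charFunDual_map, charFunDual_stdGaussian]
  have : L ∘SL ((innerSL ℝ u).prod (innerSL ℝ v)) =
      innerSL ℝ (L (1, 0) • u + L (0, 1) • v) := by
    ext g
    have : (inner ℝ u g, inner ℝ v g) =
        (inner ℝ u g : ℝ) • ((1 : ℝ), (0 : ℝ)) + (inner ℝ v g : ℝ) • ((0 : ℝ), (1 : ℝ)) := by
      simp
    simp only [ContinuousLinearMap.comp_apply, ContinuousLinearMap.prod_apply,
      innerSL_apply_apply, inner_add_left, real_inner_smul_left]
    rw [this, map_add, map_smul, map_smul]
    simp [mul_comm]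
  rw [this, innerSL_apply_norm]
  congr 3
  rw [← Complex.ofReal_pow, norm_add_sq_real, norm_smul, norm_smul, real_inner_smul_left,
    real_inner_smul_right, mul_pow, mul_pow, Real.norm_eq_abs, Real.norm_eq_abs, sq_abs, sq_abs,
    mul_assoc]

/-- The joint law of two coordinates of a standard Gaussian vector only depends on the Gram matrix
of the two directions. -/
lemma stdGaussian_map_inner_prod_eq {x y : E} {x' y' : F} (hxx : ‖x‖ = ‖x'‖) (hyy : ‖y‖ = ‖y'‖)
    (hxy : inner ℝ x y = inner ℝ x' y') :
    (stdGaussian E).map (fun g => (inner ℝ x g, inner ℝ y g)) =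
      (stdGaussian F).map (fun g => (inner ℝ x' g, inner ℝ y' g)) := by
  change (stdGaussian E).map ((innerSL ℝ x).prod (innerSL ℝ y)) =
    (stdGaussian F).map ((innerSL ℝ x').prod (innerSL ℝ y'))
  have : IsProbabilityMeasure ((stdGaussian E).map ((innerSL ℝ x).prod (innerSL ℝ y))) :=
    Measure.isProbabilityMeasure_map (by fun_prop)
  have : IsProbabilityMeasure ((stdGaussian F).map ((innerSL ℝ x').prod (innerSL ℝ y'))) :=
    Measure.isProbabilityMeasure_map (by fun_prop)
  apply Measure.ext_of_charFunDual
  ext L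
  rw [charFunDual_stdGaussian_map_inner_prod, charFunDual_stdGaussian_map_inner_prod, hxx, hyy,
    hxy]

lemma integrable_sgn_inner_mul_sgn_inner (x y : E) :
    Integrable (fun g => sgn (inner ℝ x g) * sgn (inner ℝ y g)) (stdGaussian E) := by
  refine Integrable.of_bound (C := 1) (Measurable.aestronglyMeasurable (by fun_prop)) ?_
  exact Filter.Eventually.of_forall fun g => abs_sgn_mul_sgn_le _ _

end Gaussian

lemma stdGaussian_complex_singleton_zero : stdGaussian ℂ {0} = 0 := by
  have h : (stdGaussian ℂ).map Complex.re = gaussianReal 0 1 := by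
    have := IsGaussian.map_eq_gaussianReal (μ := stdGaussian ℂ) Complex.reCLM
    rwa [integral_strongDual_stdGaussian, variance_dual_stdGaussian, Complex.reCLM_norm, one_pow,
      Real.toNNReal_one] at this
  refine measure_mono_null (t := Complex.re ⁻¹' {0}) (by simp) ?_
  rw [← Measure.map_apply (by fun_prop) (measurableSet_singleton _), h]
  have := nullSingletonClass_gaussianReal (μ := 0) (v := 1) one_ne_zero
  exact measure_singleton _

/-- Grothendieck's identity for the directions `1` and `exp (α * I)` in the plane: by rotation
invariance the Gaussian average may be replaced by an average over angles. -/
lemma integral_sgn_stdGaussian_complex {α : ℝ} (h0 : 0 ≤ α) (hπ : α ≤ Real.pi) :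
    ∫ z, sgn (inner ℝ (1 : ℂ) z) * sgn (inner ℝ (Complex.exp (α * Complex.I)) z)
      ∂(stdGaussian ℂ) = 1 - 2 * α / Real.pi := by
  set f : ℂ → ℝ :=
    fun z => sgn (inner ℝ (1 : ℂ) z) * sgn (inner ℝ (Complex.exp (α * Complex.I)) z) with hf
  have hpi := Real.pi_pos
  have hfm : Measurable f := by unfold f; fun_prop
  have hrot (θ : ℝ) : ∫ z, f (Complex.exp (θ * Complex.I) * z) ∂(stdGaussian ℂ) =
      ∫ z, f z ∂(stdGaussian ℂ) := by
    conv_rhs => rw [← stdGaussian_map (rotation (Circle.exp θ))]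
    rw [integral_map (by fun_prop) hfm.aestronglyMeasurable]
    simp [rotation_apply]
  have hpolar (z : ℂ) (hz : z ≠ 0) : ∫ θ in (0 : ℝ)..(0 + 2 * Real.pi),
      f (Complex.exp (θ * Complex.I) * z) = 2 * Real.pi - 4 * α := by
    have hval (θ : ℝ) : f (Complex.exp (θ * Complex.I) * z) =
        sgn (Real.cos (θ + z.arg)) * sgn (Real.cos (θ + z.arg - α)) := by
      have hz' : Complex.exp (θ * Complex.I) * z =
          ‖z‖ * Complex.exp ((θ + z.arg : ℝ) * Complex.I) := by
        conv_lhs => rw [← Complex.norm_mul_exp_arg_mul_I z]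
        push_cast
        rw [add_mul, Complex.exp_add]; ring
      have h2 : inner ℝ (Complex.exp (α * Complex.I)) (Complex.exp (θ * Complex.I) * z) =
          ‖z‖ * Real.cos (θ + z.arg - α) := by
        rw [hz', Complex.inner, ← Complex.exp_conj, mul_assoc, ← Complex.exp_add,
          Complex.re_ofReal_mul]
        have : ((θ + z.arg : ℝ) : ℂ) * Complex.I + (starRingEnd ℂ) (α * Complex.I) =
            ((θ + z.arg - α : ℝ) : ℂ) * Complex.I := by
          simp; ring
        rw [this, Complex.exp_ofReal_mul_I_re]
      have h1 : inner ℝ (1 : ℂ) (Complex.exp (θ * Complex.I) * z) =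
          ‖z‖ * Real.cos (θ + z.arg) := by
        rw [hz', Complex.inner, map_one, mul_one, Complex.re_ofReal_mul,
          Complex.exp_ofReal_mul_I_re]
      have hn : 0 < ‖z‖ := norm_pos_iff.2 hz
      simp only [hf]
      rw [h1, h2, sgn_mul_of_pos hn, sgn_mul_of_pos hn]
    simp_rw [hval]
    rw [intervalIntegral.integral_comp_add_right
      (fun θ => sgn (Real.cos θ) * sgn (Real.cos (θ - α)))]
    rw [← integral_sgn_cos_mul_sgn_cos h0 hπ, add_right_comm]
    refine Function.Periodic.intervalIntegral_add_eq (fun θ => ?_) _ _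
    rw [Real.cos_add_two_pi, add_sub_right_comm, Real.cos_add_two_pi]
  have hswap : ∫ θ in (0 : ℝ)..(0 + 2 * Real.pi), ∫ z, f (Complex.exp (θ * Complex.I) * z)
      ∂(stdGaussian ℂ) = ∫ z, (∫ θ in (0 : ℝ)..(0 + 2 * Real.pi),
        f (Complex.exp (θ * Complex.I) * z)) ∂(stdGaussian ℂ) := by
    apply intervalIntegral_integral_swap
    have : IsFiniteMeasure (volume.restrict (Set.uIoc 0 (0 + 2 * Real.pi))) :=
      ⟨by rw [Measure.restrict_apply_univ]; exact measure_Ioc_lt_top⟩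
    refine Integrable.of_bound (C := 1) (Measurable.aestronglyMeasurable ?_) ?_
    · exact hfm.comp (by fun_prop)
    · exact Filter.Eventually.of_forall fun g => abs_sgn_mul_sgn_le _ _
  have hae : (fun z => ∫ θ in (0 : ℝ)..(0 + 2 * Real.pi), f (Complex.exp (θ * Complex.I) * z))
      =ᵐ[stdGaussian ℂ] fun _ => 2 * Real.pi - 4 * α := by
    have : ∀ᵐ z ∂(stdGaussian ℂ), z ≠ 0 := by
      rw [ae_iff]; simpa using stdGaussian_complex_singleton_zero
    filter_upwards [this] with z hz using hpolar z hz
  rw [integral_congr_ae hae] at hswap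
  simp_rw [hrot] at hswap
  simp at hswap
  field_simp
  linarith

/-- Grothendieck's identity: the correlation of the signs of two coordinates of a standard Gaussian
vector is `2 / π` times the arcsine of the inner product of the two directions. -/
theorem integral_sgn_inner_mul_sgn_inner {E : Type*} [NormedAddCommGroup E]
    [InnerProductSpace ℝ E] [FiniteDimensional ℝ E] [MeasurableSpace E] [BorelSpace E]
    {x y : E} (hx : ‖x‖ = 1) (hy : ‖y‖ = 1) :
    ∫ g, sgn (inner ℝ x g) * sgn (inner ℝ y g) ∂(stdGaussian E) =
      2 / Real.pi * Real.arcsin (inner ℝ x y) := by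
  have hb : |inner ℝ x y| ≤ 1 := by
    simpa [hx, hy] using abs_real_inner_le_norm x y
  obtain ⟨hb1, hb2⟩ := abs_le.1 hb
  have hlaw := stdGaussian_map_inner_prod_eq (x := x) (y := y) (x' := (1 : ℂ))
    (y' := Complex.exp (Real.arccos (inner ℝ x y) * Complex.I)) (by simp [hx])
    (by rw [Complex.norm_exp_ofReal_mul_I, hy])
    (by rw [Complex.inner, map_one, mul_one, Complex.exp_ofReal_mul_I_re,
      Real.cos_arccos hb1 hb2])
  have hm : Measurable fun p : ℝ × ℝ => sgn p.1 * sgn p.2 := by fun_prop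
  have h1 := integral_map (μ := stdGaussian E) (φ := fun g => (inner ℝ x g, inner ℝ y g))
    (by fun_prop) hm.aestronglyMeasurable
  rw [← h1, hlaw, integral_map (by fun_prop) hm.aestronglyMeasurable]
  simp only []
  rw [integral_sgn_stdGaussian_complex (Real.arccos_nonneg _) (Real.arccos_le_pi _),
    Real.arccos]
  field_simp
  ring

/-! ### Krivine's bound for the Grothendieck constant -/

section Krivine

open Matrix

variable {ι : Type*} [Fintype ι]

lemma dotProduct_mulVec_eq_sum (A : Matrix ι ι ℝ) (x : ι → ℝ) :
    x ⬝ᵥ A *ᵥ x = ∑ a, ∑ b, x a * x b * A a b := by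
  simp only [dotProduct, mulVec, Finset.mul_sum]
  exact Finset.sum_congr rfl fun a _ => Finset.sum_congr rfl fun b _ => by ring

lemma sum_mul_nonneg_of_posSemidef {A : Matrix ι ι ℝ} (hA : A.PosSemidef) (x : ι → ℝ) :
    0 ≤ ∑ a, ∑ b, x a * x b * A a b := by
  rw [← dotProduct_mulVec_eq_sum]
  simpa using (posSemidef_iff_dotProduct_mulVec.1 hA).2 x

lemma posSemidef_map_pow {κ : Type*} {A : Matrix κ κ ℝ} (hA : A.PosSemidef) (k : ℕ) :
    (A.map (· ^ (k + 1))).PosSemidef := by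
  induction k with
  | zero => simpa using hA
  | succ k ih =>
    have h : A.map (· ^ (k + 1 + 1)) = (A.map (· ^ (k + 1))).hadamard A := by
      ext a b
      simp [pow_succ]
    rw [h]
    exact ih.hadamard hA

lemma exists_inner_eq_of_posSemidef {A : Matrix ι ι ℝ} (hA : A.PosSemidef) :
    ∃ z : ι → EuclideanSpace ℝ ι, ∀ a b, inner ℝ (z a) (z b) = A a b := by
  classical
  open scoped MatrixOrder in
  obtain ⟨B, rfl⟩ := CStarAlgebra.nonneg_iff_eq_star_mul_self.1 hA.nonneg
  refine ⟨fun a => WithLp.toLp 2 fun l => B l a, fun a b => ?_⟩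
  simp [PiLp.inner_apply, star_eq_conjTranspose, mul_apply, mul_comm]

/-- The matrix with entries `sinh (c * G a b)` for `a`, `b` on the same side of the bipartition
and `sin (c * G a b)` for `a`, `b` on different sides. -/
noncomputable def krivineMatrix {p q : ℕ} (c : ℝ) (G : Matrix (Fin p ⊕ Fin q) (Fin p ⊕ Fin q) ℝ) :
    Matrix (Fin p ⊕ Fin q) (Fin p ⊕ Fin q) ℝ := fun a b =>
  if a.isLeft = b.isLeft then Real.sinh (c * G a b) else Real.sin (c * G a b)

/-- The power series of `sinh` and `sin` have the same coefficients up to sign, and the signs can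
be moved into the vectors on which the quadratic form is evaluated; what remains are Hadamard powers
of `G`. -/
lemma posSemidef_krivineMatrix {p q : ℕ} {c : ℝ} (hc : 0 ≤ c)
    {G : Matrix (Fin p ⊕ Fin q) (Fin p ⊕ Fin q) ℝ} (hG : G.PosSemidef) :
    (krivineMatrix c G).PosSemidef := by
  have hsymm (a b) : G b a = G a b := by simpa using hG.isHermitian.apply a b
  refine PosSemidef.of_dotProduct_mulVec_nonneg ?_ fun x => ?_
  · ext a b
    simp [krivineMatrix, hsymm a b, eq_comm]
  let σ : Fin p ⊕ Fin q → ℝ := Sum.elim (fun _ => 1) (fun _ => -1)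
  have hterm (a b) : HasSum (fun k : ℕ => σ a ^ k * σ b ^ k *
      ((c * G a b) ^ (2 * k + 1) / (2 * k + 1).factorial)) (krivineMatrix c G a b) := by
    rcases a with a | a <;> rcases b with b | b
    · simpa [krivineMatrix, σ] using Real.hasSum_sinh (c * G (.inl a) (.inl b))
    · simpa [krivineMatrix, σ, mul_div_assoc] using Real.hasSum_sin (c * G (.inl a) (.inr b))
    · simpa [krivineMatrix, σ, mul_div_assoc] using Real.hasSum_sin (c * G (.inr a) (.inl b))
    · simpa [krivineMatrix, σ, ← mul_pow] using Real.hasSum_sinh (c * G (.inr a) (.inr b))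
  have hsum : HasSum (fun k : ℕ => ∑ a, ∑ b, x a * x b * (σ a ^ k * σ b ^ k *
      ((c * G a b) ^ (2 * k + 1) / (2 * k + 1).factorial)))
      (∑ a, ∑ b, x a * x b * krivineMatrix c G a b) :=
    hasSum_sum fun a _ => hasSum_sum fun b _ => (hterm a b).mul_left _
  rw [star_trivial, dotProduct_mulVec_eq_sum]
  refine hsum.nonneg fun k => ?_
  have h := sum_mul_nonneg_of_posSemidef (posSemidef_map_pow hG (2 * k)) (fun a => σ a ^ k * x a)
  have : (0 : ℝ) ≤ c ^ (2 * k + 1) / (2 * k + 1).factorial := by positivity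
  refine (mul_nonneg this h).trans_eq ?_
  simp only [Finset.mul_sum, map_apply]
  exact Finset.sum_congr rfl fun a _ => Finset.sum_congr rfl fun b _ => by
    rw [mul_pow]; ring

/-- The Gram matrix of vectors in the unit ball, with its diagonal entries raised to `1`, is a
positive semidefinite matrix. -/
lemma exists_posSemidef_diag_one {p q k : ℕ} (u : Fin p → EuclideanSpace ℝ (Fin k))
    (v : Fin q → EuclideanSpace ℝ (Fin k)) (hu : ∀ i, ‖u i‖ ≤ 1) (hv : ∀ j, ‖v j‖ ≤ 1) :
    ∃ G : Matrix (Fin p ⊕ Fin q) (Fin p ⊕ Fin q) ℝ, G.PosSemidef ∧ (∀ a, G a a = 1) ∧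
      ∀ i j, G (.inl i) (.inr j) = inner ℝ (u i) (v j) := by
  let w : Fin p ⊕ Fin q → EuclideanSpace ℝ (Fin k) := Sum.elim u v
  have hw (a) : ‖w a‖ ≤ 1 := by rcases a with a | a <;> simp [w, hu, hv]
  refine ⟨gram ℝ w + diagonal fun a => 1 - ‖w a‖ ^ 2,
    (posSemidef_gram ℝ w).add (PosSemidef.diagonal fun a => ?_), fun a => ?_, fun i j => ?_⟩
  · have := pow_le_one₀ (n := 2) (norm_nonneg _) (hw a)
    simpa using this
  · simp
  · simp [w]

/-- The vectors with Gram matrix `krivineMatrix (arsinh 1) G` are unit vectors since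
`sinh (arsinh 1) = 1`. Rounding them by the signs of a Gaussian vector undoes the sine, so that the
expectation of the rounded sum is proportional to the original sum. -/
theorem grothendieckInequality_krivine :
    GrothendieckInequality (Real.pi / (2 * Real.arsinh 1)) := by
  intro p q k M hM u v hu hv
  obtain ⟨G, hG, hG1, hGuv⟩ := exists_posSemidef_diag_one u v hu hv
  simp_rw [← hGuv]
  set c := Real.arsinh 1 with hc
  have hc0 : 0 < c := Real.arsinh_pos_iff.2 one_pos
  have hc1 : c ≤ Real.pi / 2 := by
    have h1 : c ≤ Real.sinh c := Real.self_le_sinh_iff.2 hc0.le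
    rw [hc, Real.sinh_arsinh] at h1
    have := Real.pi_gt_three
    linarith
  obtain ⟨z, hz⟩ := exists_inner_eq_of_posSemidef (posSemidef_krivineMatrix hc0.le hG)
  have hz1 (a) : ‖z a‖ = 1 := by
    have := hz a a
    rw [real_inner_self_eq_norm_sq] at this
    rw [← pow_eq_one_iff_of_nonneg (norm_nonneg _) two_ne_zero, this]
    simp [krivineMatrix, hG1, c]
  have hGle (a b) : |G a b| ≤ 1 := by
    obtain ⟨y, hy⟩ := exists_inner_eq_of_posSemidef hG
    have hy1 (a) : ‖y a‖ = 1 := by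
      have := hy a a
      rw [real_inner_self_eq_norm_sq, hG1] at this
      exact (pow_eq_one_iff_of_nonneg (norm_nonneg _) two_ne_zero).1 this
    simpa [hy, hy1] using abs_real_inner_le_norm (y a) (y b)
  have hid (i j) : ∫ g, sgn (inner ℝ (z (.inl i)) g) * sgn (inner ℝ (z (.inr j)) g)
      ∂(stdGaussian (EuclideanSpace ℝ (Fin p ⊕ Fin q))) =
        2 * c / Real.pi * G (.inl i) (.inr j) := by
    rw [integral_sgn_inner_mul_sgn_inner (hz1 _) (hz1 _), hz]
    have := abs_le.1 (hGle (.inl i) (.inr j))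
    simp only [krivineMatrix, Sum.isLeft_inl, Sum.isLeft_inr, Bool.true_eq_false, if_false]
    rw [Real.arcsin_sin (by nlinarith) (by nlinarith)]
    ring
  have hint : ∫ g, ∑ i, ∑ j, M i j * (sgn (inner ℝ (z (.inl i)) g) *
      sgn (inner ℝ (z (.inr j)) g)) ∂(stdGaussian (EuclideanSpace ℝ (Fin p ⊕ Fin q))) =
        2 * c / Real.pi * ∑ i, ∑ j, M i j * G (.inl i) (.inr j) := by
    have hI (i j) := (integrable_sgn_inner_mul_sgn_inner (z (.inl i)) (z (.inr j))).const_mul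
      (M i j)
    rw [integral_finsetSum _ fun i _ => integrable_finsetSum _ fun j _ => hI i j, Finset.mul_sum]
    refine Finset.sum_congr rfl fun i _ => ?_
    rw [integral_finsetSum _ fun j _ => hI i j, Finset.mul_sum]
    refine Finset.sum_congr rfl fun j _ => ?_
    rw [integral_const_mul, hid]
    ring
  have hle := norm_integral_le_of_norm_le_const
    (μ := stdGaussian (EuclideanSpace ℝ (Fin p ⊕ Fin q))) (C := 1)
    (f := fun g => ∑ i, ∑ j, M i j * (sgn (inner ℝ (z (.inl i)) g) * sgn (inner ℝ (z (.inr j)) g)))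
    (Filter.Eventually.of_forall fun g => hM _ _ (fun i => sgn_eq _) (fun j => sgn_eq _))
  have hpi := Real.pi_pos
  rw [hint, Real.norm_eq_abs, abs_mul, abs_of_pos (by positivity)] at hle
  simp at hle
  rw [le_div_iff₀ (by positivity)]
  rw [div_mul_eq_mul_div, div_le_one hpi] at hle
  linarith

end Krivine

/-- The bound `4 * K ≤ 7.13` for `K = π / (2 * arsinh 1)` amounts to `2 * π / 7.13 ≤ arsinh 1`, where
`2 * π / 7.13 < 0.88124`. -/
lemma le_arsinh_one : (0.8813 : ℝ) ≤ Real.arsinh 1 := by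
  have h := Real.exp_bound' (x := 0.8813) (by norm_num) (by norm_num) (n := 10) (by norm_num)
  have h2 : (1.4142 : ℝ) ≤ √2 := Real.le_sqrt_of_sq_le (by norm_num)
  rw [← Real.exp_le_exp, Real.exp_arsinh]
  norm_num [Finset.sum_range_succ, Nat.factorial] at h h2 ⊢
  linarith

lemma GrothendieckInequality.nonneg {K : ℝ} (hK : GrothendieckInequality K) : 0 ≤ K := by
  simpa using hK 0 0 0 0 (by simp) (fun _ => 0) (fun _ => 0) (by simp) (by simp)

theorem isLeast_grothendieckConstant :
    IsLeast {K : ℝ | GrothendieckInequality K} grothendieckConstant := by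
  have hbdd : BddBelow {K : ℝ | GrothendieckInequality K} := ⟨0, fun K hK => hK.nonneg⟩
  refine ⟨fun p q k M hM u v hu hv => ?_, fun K hK => csInf_le hbdd hK⟩
  exact le_csInf ⟨_, grothendieckInequality_krivine⟩ fun K hK => hK p q k M hM u v hu hv

theorem four_mul_grothendieckConstant_le : 4 * grothendieckConstant ≤ 7.13 := by
  have h := isLeast_grothendieckConstant.2 grothendieckInequality_krivine
  have h1 := le_arsinh_one
  have h2 : Real.pi / (2 * Real.arsinh 1) ≤ 7.13 / 4 := by
    rw [div_le_iff₀ (by linarith)]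
    have := Real.pi_lt_d4
    linarith
  linarith

/-! ### The second largest eigenvalue as the maximum of a quadratic form -/

section Spectral

open Matrix

/-- All eigenvalues but one are at most the second largest one. -/
lemma exists_forall_ne_eigenvalues_le {V : Type*} [Fintype V] [DecidableEq V]
    {A : Matrix V V ℝ} (hA : A.IsHermitian) (hV : 1 < Fintype.card V) :
    ∃ i₀, ∀ i, i ≠ i₀ → hA.eigenvalues i ≤ hA.eigenvalues₀ ⟨1, hV⟩ := by
  let e : Fin (Fintype.card V) ≃ V := Fintype.equivOfCardEq (Fintype.card_fin _)
  refine ⟨e ⟨0, by omega⟩, fun i hi => hA.eigenvalues₀_antitone ?_⟩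
  change (⟨1, hV⟩ : Fin _) ≤ e.symm i
  have : e.symm i ≠ ⟨0, by omega⟩ := fun h => hi (by rw [← h, e.apply_symm_apply])
  rw [Fin.le_def]
  exact Nat.one_le_iff_ne_zero.2 fun h => this (Fin.ext h)

/-- Coordinates in an orthonormal eigenbasis: Parseval's identity holds, and the matrix acts
diagonally. -/
lemma exists_linearMap_diagonalizing {V : Type*} [Fintype V] [DecidableEq V] {A : Matrix V V ℝ}
    (hA : A.IsHermitian) : ∃ coord : (V → ℝ) →ₗ[ℝ] V → ℝ,
      (∀ y z, ∑ i, coord y i * coord z i = y ⬝ᵥ z) ∧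
        ∀ y i, coord (A *ᵥ y) i = hA.eigenvalues i * coord y i := by
  refine ⟨LinearMap.pi fun i => (dotProductBilin ℝ ℝ).flip (hA.eigenvectorBasis i).ofLp,
    fun y z => ?_, fun y i => ?_⟩
  · have := hA.eigenvectorBasis.sum_inner_mul_inner (WithLp.toLp 2 y) (WithLp.toLp 2 z)
    simp only [EuclideanSpace.inner_eq_star_dotProduct, star_trivial] at this
    rw [dotProduct_comm y z, ← this]
    refine Finset.sum_congr rfl fun i _ => ?_
    rw [dotProduct_comm (hA.eigenvectorBasis i).ofLp]
    rfl
  · have hAs : A.IsSymm := by simpa [conjTranspose] using hA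
    change A *ᵥ y ⬝ᵥ (hA.eigenvectorBasis i).ofLp = _ * (y ⬝ᵥ (hA.eigenvectorBasis i).ofLp)
    rw [dotProduct_comm, dotProduct_mulVec, ← mulVec_transpose, hAs.eq,
      hA.mulVec_eigenvectorBasis, smul_dotProduct, smul_eq_mul, dotProduct_comm]

/-- A Courant–Fischer bound: if `w` is an eigenvector for an eigenvalue `μ` that bounds the whole
quadratic form, then on the orthogonal complement of `w` the form is bounded by the second largest
eigenvalue. -/
lemma dotProduct_mulVec_le_eigenvalues₀_one {V : Type*} [Fintype V] [DecidableEq V]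
    {A : Matrix V V ℝ} (hA : A.IsHermitian) (hV : 1 < Fintype.card V) {w : V → ℝ} {μ : ℝ}
    (hw0 : w ≠ 0) (hw : A *ᵥ w = μ • w) (hμ : ∀ x, x ⬝ᵥ A *ᵥ x ≤ μ * (x ⬝ᵥ x))
    {x : V → ℝ} (hx : x ⬝ᵥ w = 0) :
    x ⬝ᵥ A *ᵥ x ≤ hA.eigenvalues₀ ⟨1, hV⟩ * (x ⬝ᵥ x) := by
  obtain ⟨i₀, hl⟩ := exists_forall_ne_eigenvalues_le hA hV
  obtain ⟨coord, hpars, hcoordA⟩ := exists_linearMap_diagonalizing hA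
  generalize hA.eigenvalues₀ ⟨1, hV⟩ = l at hl ⊢
  generalize hA.eigenvalues = ev at hl hcoordA
  have hquad : x ⬝ᵥ A *ᵥ x = ∑ i, ev i * coord x i ^ 2 := by
    rw [← hpars]
    refine Finset.sum_congr rfl fun i _ => ?_
    rw [hcoordA]; ring
  have hnorm : x ⬝ᵥ x = ∑ i, coord x i ^ 2 := by
    rw [← hpars]
    exact Finset.sum_congr rfl fun i _ => by ring
  by_cases hx0 : coord x i₀ = 0
  · rw [hquad, hnorm, Finset.mul_sum]
    refine Finset.sum_le_sum fun i _ => ?_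
    by_cases hi : i = i₀
    · simp [hi, hx0]
    · exact mul_le_mul_of_nonneg_right (hl i hi) (sq_nonneg _)
  -- Otherwise `w` has a nonzero coordinate away from `i₀`, so that `μ` is one of the eigenvalues
  -- which are at most `l`.
  have hwμ (i : V) : coord w i = 0 ∨ ev i = μ := by
    have h := hcoordA w i
    rw [hw, map_smul, Pi.smul_apply, smul_eq_mul] at h
    rcases eq_or_ne (coord w i) 0 with h0 | h0
    · exact .inl h0
    · exact .inr (mul_right_cancel₀ h0 h).symm
  obtain ⟨i, hi, hwi⟩ : ∃ i, i ≠ i₀ ∧ coord w i ≠ 0 := by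
    by_contra! hcon
    have hsum : ∑ i, coord x i * coord w i = coord x i₀ * coord w i₀ :=
      Fintype.sum_eq_single i₀ fun i hi => by rw [hcon i hi, mul_zero]
    rw [hpars, hx, eq_comm] at hsum
    have hw1 : coord w i₀ = 0 := (mul_eq_zero.1 hsum).resolve_left hx0
    refine hw0 (dotProduct_self_eq_zero.1 ?_)
    rw [← hpars]
    refine Finset.sum_eq_zero fun i _ => ?_
    by_cases hi : i = i₀
    · rw [hi, hw1, mul_zero]
    · rw [hcon i hi, mul_zero]
  have hμl : μ ≤ l := ((hwμ i).resolve_left hwi) ▸ hl i hi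
  refine (hμ x).trans (mul_le_mul_of_nonneg_right hμl ?_)
  rw [hnorm]
  positivity

end Spectral

/-! ### Discrepancy of biregular bipartite graphs -/

section Expander

open Matrix

variable {n m d₁ d₂ : ℕ} {G : SimpleGraph (Fin n ⊕ Fin m)} [DecidableRel G.Adj]

/-- The biadjacency matrix of a bipartite graph. -/
def biadj (G : SimpleGraph (Fin n ⊕ Fin m)) [DecidableRel G.Adj] (i : Fin n) (j : Fin m) : ℝ :=
  if G.Adj (.inl i) (.inr j) then 1 else 0

lemma biadj_nonneg (i : Fin n) (j : Fin m) : 0 ≤ biadj G i j := by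
  unfold biadj; split_ifs <;> simp

lemma IsBiregular.adjMatrix_mulVec_inl (hG : IsBiregular G d₁ d₂) (p : Fin n → ℝ) (q : Fin m → ℝ)
    (i : Fin n) : (G.adjMatrix ℝ *ᵥ Sum.elim p q) (.inl i) = ∑ j, biadj G i j * q j := by
  have h (k : Fin n) : ¬ G.Adj (.inl i) (.inl k) := fun h => by simpa using hG.bipartite h
  simp [mulVec, dotProduct, SimpleGraph.adjMatrix_apply, h, biadj]

lemma IsBiregular.adjMatrix_mulVec_inr (hG : IsBiregular G d₁ d₂) (p : Fin n → ℝ) (q : Fin m → ℝ)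
    (j : Fin m) : (G.adjMatrix ℝ *ᵥ Sum.elim p q) (.inr j) = ∑ i, biadj G i j * p i := by
  have h (k : Fin m) : ¬ G.Adj (.inr k) (.inr j) := fun h => by simpa using hG.bipartite h
  simp [mulVec, dotProduct, SimpleGraph.adjMatrix_apply, h, biadj, G.adj_comm (.inr j)]

lemma IsBiregular.sum_biadj_right (hG : IsBiregular G d₁ d₂) (i : Fin n) :
    ∑ j, biadj G i j = d₁ := by
  have h := hG.adjMatrix_mulVec_inl (fun _ => 1) (fun _ => 1) i
  have h2 : (Sum.elim (fun _ => 1) (fun _ => 1) : Fin n ⊕ Fin m → ℝ) = Function.const _ 1 := by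
    ext (a | a) <;> rfl
  rw [h2, SimpleGraph.adjMatrix_mulVec_const_apply, hG.degree_left] at h
  simpa using h.symm

lemma IsBiregular.sum_biadj_left (hG : IsBiregular G d₁ d₂) (j : Fin m) :
    ∑ i, biadj G i j = d₂ := by
  have h := hG.adjMatrix_mulVec_inr (fun _ => 1) (fun _ => 1) j
  have h2 : (Sum.elim (fun _ => 1) (fun _ => 1) : Fin n ⊕ Fin m → ℝ) = Function.const _ 1 := by
    ext (a | a) <;> rfl
  rw [h2, SimpleGraph.adjMatrix_mulVec_const_apply, hG.degree_right] at h
  simpa using h.symm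

lemma IsBiregular.card_edges_eq (hG : IsBiregular G d₁ d₂) : (n : ℝ) * d₁ = m * d₂ := by
  have h : ∑ i, ∑ j, biadj G i j = ∑ j, ∑ i, biadj G i j := Finset.sum_comm
  simpa [hG.sum_biadj_left, hG.sum_biadj_right] using h

lemma IsBiregular.dotProduct_adjMatrix (hG : IsBiregular G d₁ d₂) (p : Fin n → ℝ)
    (q : Fin m → ℝ) : Sum.elim p q ⬝ᵥ G.adjMatrix ℝ *ᵥ Sum.elim p q =
      2 * ∑ i, ∑ j, biadj G i j * (p i * q j) := by
  simp only [dotProduct, Fintype.sum_sum_type, hG.adjMatrix_mulVec_inl, hG.adjMatrix_mulVec_inr,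
    Sum.elim_inl, Sum.elim_inr, Finset.mul_sum]
  rw [Finset.sum_comm (γ := Fin m) (α := Fin n) (f := fun j i => q j * _), ← Finset.sum_add_distrib]
  refine Finset.sum_congr rfl fun i _ => ?_
  rw [← Finset.sum_add_distrib]
  exact Finset.sum_congr rfl fun j _ => by ring

/-- The quadratic form of the adjacency matrix is bounded by `√(d₁ d₂)`, the eigenvalue of the
eigenvector `(√d₁, √d₂)`; on its orthogonal complement the second eigenvalue takes over. -/
lemma IsBiregular.sum_biadj_mul_le (hG : IsBiregular G d₁ d₂) (h₁ : 0 < d₁) (h₂ : 0 < d₂)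
    (hnm : 2 < n + m) {p : Fin n → ℝ} {q : Fin m → ℝ} (hp : ∑ i, p i = 0) (hq : ∑ j, q j = 0) :
    2 * ∑ i, ∑ j, biadj G i j * (p i * q j) ≤
      secondEigenvalue G * (∑ i, p i ^ 2 + ∑ j, q j ^ 2) := by
  have hV : 1 < Fintype.card (Fin n ⊕ Fin m) := by simp; omega
  have hd₁ : (0 : ℝ) < √d₁ := by positivity
  have hd₂ : (0 : ℝ) < √d₂ := by positivity
  have hs₁ : √(d₁ : ℝ) * √d₁ = d₁ := Real.mul_self_sqrt (by positivity)
  have hs₂ : √(d₂ : ℝ) * √d₂ = d₂ := Real.mul_self_sqrt (by positivity)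
  have hself (p : Fin n → ℝ) (q : Fin m → ℝ) :
      Sum.elim p q ⬝ᵥ Sum.elim p q = ∑ i, p i ^ 2 + ∑ j, q j ^ 2 := by
    simp [dotProduct, pow_two]
  rw [secondEigenvalue, dif_pos hV, ← hG.dotProduct_adjMatrix, ← hself]
  refine dotProduct_mulVec_le_eigenvalues₀_one _ hV (w := Sum.elim (fun _ => √d₁) (fun _ => √d₂))
    (μ := √d₁ * √d₂) ?_ ?_ (fun x => ?_) ?_
  · intro h
    obtain ⟨v⟩ : Nonempty (Fin n ⊕ Fin m) := Fintype.card_pos_iff.1 (by omega)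
    have := congrFun h v
    rcases v with v | v
    · exact hd₁.ne' this
    · exact hd₂.ne' this
  · ext (i | j)
    · rw [hG.adjMatrix_mulVec_inl, ← Finset.sum_mul, hG.sum_biadj_right]
      simp only [Pi.smul_apply, Sum.elim_inl, smul_eq_mul]
      linear_combination -√d₂ * hs₁
    · rw [hG.adjMatrix_mulVec_inr, ← Finset.sum_mul, hG.sum_biadj_left]
      simp only [Pi.smul_apply, Sum.elim_inr, smul_eq_mul]
      linear_combination -√d₁ * hs₂
  · obtain ⟨p, q, rfl⟩ : ∃ p q, x = Sum.elim p q := ⟨_, _, (Sum.elim_comp_inl_inr x).symm⟩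
    rw [hG.dotProduct_adjMatrix, hself, Finset.mul_sum]
    have key (i j) : 2 * (biadj G i j * (p i * q j)) ≤
        biadj G i j * (√d₂ / √d₁ * p i ^ 2) + biadj G i j * (√d₁ / √d₂ * q j ^ 2) := by
      have : 2 * (p i * q j) ≤ √d₂ / √d₁ * p i ^ 2 + √d₁ / √d₂ * q j ^ 2 := by
        rw [← sub_nonneg]
        have : √d₂ / √d₁ * p i ^ 2 + √d₁ / √d₂ * q j ^ 2 - 2 * (p i * q j) =
            (√d₂ * p i - √d₁ * q j) ^ 2 / (√d₁ * √d₂) := by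
          field_simp; ring
        rw [this]; positivity
      have := mul_le_mul_of_nonneg_left this (biadj_nonneg (G := G) i j)
      linarith
    calc ∑ i, 2 * ∑ j, biadj G i j * (p i * q j)
        ≤ ∑ i, ∑ j, (biadj G i j * (√d₂ / √d₁ * p i ^ 2) +
            biadj G i j * (√d₁ / √d₂ * q j ^ 2)) := by
          refine Finset.sum_le_sum fun i _ => ?_
          rw [Finset.mul_sum]
          exact Finset.sum_le_sum fun j _ => key i j
      _ = ∑ i, d₁ * (√d₂ / √d₁ * p i ^ 2) + ∑ j, d₂ * (√d₁ / √d₂ * q j ^ 2) := by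
          simp_rw [Finset.sum_add_distrib]
          rw [Finset.sum_comm (γ := Fin n) (α := Fin m)
            (f := fun i j => biadj G i j * (√d₁ / √d₂ * q j ^ 2))]
          simp_rw [← Finset.sum_mul, hG.sum_biadj_left, hG.sum_biadj_right]
      _ = √d₁ * √d₂ * (∑ i, p i ^ 2 + ∑ j, q j ^ 2) := by
          rw [mul_add, Finset.mul_sum, Finset.mul_sum]
          congr 1 <;> refine Finset.sum_congr rfl fun _ _ => ?_
          · rw [div_mul_comm, ← mul_assoc, mul_div_left_comm, Real.div_sqrt]; ring
          · rw [div_mul_comm, ← mul_assoc, mul_div_left_comm, Real.div_sqrt]; ring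
  · simp [dotProduct, ← Finset.sum_mul, hp, hq]

lemma IsBiregular.pos_left (hG : IsBiregular G d₁ d₂) (h₂ : 0 < d₂) (hnm : 2 < n + m) :
    0 < n := by
  rcases Nat.eq_zero_or_pos n with rfl | h
  · have h := hG.card_edges_eq
    have : 0 < m := by omega
    simp [this.ne', h₂.ne'] at h
  · exact h

lemma IsBiregular.pos_right (hG : IsBiregular G d₁ d₂) (h₁ : 0 < d₁) (hnm : 2 < n + m) :
    0 < m := by
  rcases Nat.eq_zero_or_pos m with rfl | h
  · have h := hG.card_edges_eq
    have : 0 < n := by omega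
    simp [this.ne', h₁.ne'] at h
  · exact h

/-- A part with at least two vertices carries a nonzero vector of sum zero, on which the quadratic
form of the adjacency matrix vanishes. -/
lemma IsBiregular.secondEigenvalue_nonneg (hG : IsBiregular G d₁ d₂) (h₁ : 0 < d₁) (h₂ : 0 < d₂)
    (hnm : 2 < n + m) : 0 ≤ secondEigenvalue G := by
  have hvec {k : ℕ} (hk : 1 < k) : ∃ p : Fin k → ℝ, ∑ i, p i = 0 ∧ 0 < ∑ i, p i ^ 2 := by
    refine ⟨Pi.single ⟨0, by omega⟩ 1 - Pi.single ⟨1, hk⟩ 1, by simp, ?_⟩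
    refine Finset.sum_pos' (fun i _ => sq_nonneg _) ⟨⟨0, by omega⟩, Finset.mem_univ _, ?_⟩
    simp
  rcases lt_or_ge 1 n with hn | hn
  · obtain ⟨p, hp, hp'⟩ := hvec hn
    have h := hG.sum_biadj_mul_le h₁ h₂ hnm hp (q := 0) (by simp)
    simp at h
    exact nonneg_of_mul_nonneg_left h hp'
  · obtain ⟨q, hq, hq'⟩ := hvec (k := m) (by omega)
    have h := hG.sum_biadj_mul_le h₁ h₂ hnm (p := 0) (by simp) hq
    simp at h
    exact nonneg_of_mul_nonneg_left h hq'

lemma sum_sub_mean {k : ℕ} (hk : 0 < k) (s : Fin k → ℝ) :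
    ∑ i, (s i - (∑ l, s l) / k) = 0 := by
  have : (k : ℝ) ≠ 0 := by positivity
  simp [Finset.sum_sub_distrib]
  field_simp; ring

lemma sum_sub_mean_sq_le {k : ℕ} (hk : 0 < k) {s : Fin k → ℝ} (hs : ∀ i, s i = 1 ∨ s i = -1) :
    ∑ i, (s i - (∑ l, s l) / k) ^ 2 ≤ k := by
  have hk' : (k : ℝ) ≠ 0 := by positivity
  have hs2 (i) : s i ^ 2 = 1 := by rcases hs i with h | h <;> simp [h]
  have : ∑ i, (s i - (∑ l, s l) / k) ^ 2 = k - (∑ l, s l) ^ 2 / k := by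
    simp_rw [sub_sq, hs2, Finset.sum_add_distrib, Finset.sum_sub_distrib, ← Finset.sum_mul,
      ← Finset.mul_sum]
    simp
    field_simp; ring
  rw [this]
  have : 0 ≤ (∑ l, s l) ^ 2 / k := by positivity
  linarith

/-- The deviation of the biadjacency matrix, divided by the number `n * d₁` of edges, from the uniform
matrix. -/
noncomputable def discrepancyMatrix (G : SimpleGraph (Fin n ⊕ Fin m)) [DecidableRel G.Adj]
    (d₁ : ℕ) : Matrix (Fin n) (Fin m) ℝ :=
  fun i j => 1 / ((n : ℝ) * m) - biadj G i j / (n * d₁)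

/-- Pairing the discrepancy matrix with two vectors amounts to pairing the biadjacency matrix with
the centred vectors. -/
lemma IsBiregular.sum_discrepancyMatrix (hG : IsBiregular G d₁ d₂) (h₁ : 0 < d₁) (h₂ : 0 < d₂)
    (hnm : 2 < n + m) (s : Fin n → ℝ) (t : Fin m → ℝ) :
    ∑ i, ∑ j, discrepancyMatrix G d₁ i j * (s i * t j) = -(∑ i, ∑ j, biadj G i j *
      ((s i - (∑ l, s l) / n) * (t j - (∑ l, t l) / m))) / (n * d₁) := by
  have hn : (0 : ℝ) < n := by exact_mod_cast hG.pos_left h₂ hnm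
  have hm : (0 : ℝ) < m := by exact_mod_cast hG.pos_right h₁ hnm
  have hd₁ : (0 : ℝ) < d₁ := by positivity
  have hE := hG.card_edges_eq
  set S := ∑ l, s l with hS
  set T := ∑ l, t l with hT
  have e1 : ∑ i, ∑ j, discrepancyMatrix G d₁ i j * (s i * t j) =
      S * T / (n * m) - (∑ i, ∑ j, biadj G i j * (s i * t j)) / (n * d₁) := by
    simp only [discrepancyMatrix, sub_mul, Finset.sum_sub_distrib]
    rw [Finset.sum_div, hS, hT, Finset.sum_mul_sum, Finset.sum_div]
    congr 1 <;> refine Finset.sum_congr rfl fun i _ => ?_ <;> rw [Finset.sum_div] <;>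
      exact Finset.sum_congr rfl fun j _ => by ring
  have e2 : ∑ i, ∑ j, biadj G i j * (s i * (T / m)) = d₁ * S * (T / m) := by
    simp_rw [← Finset.sum_mul, hG.sum_biadj_right, ← mul_assoc, ← Finset.sum_mul,
      ← Finset.mul_sum, hS]
  have e3 : ∑ i, ∑ j, biadj G i j * (S / n * t j) = d₂ * T * (S / n) := by
    rw [Finset.sum_comm]
    simp_rw [← Finset.sum_mul, hG.sum_biadj_left, mul_comm (S / n), ← mul_assoc, ← Finset.sum_mul,
      ← Finset.mul_sum, hT]
  have e4 : ∑ i, ∑ j, biadj G i j * (S / n * (T / m)) = n * d₁ * (S / n * (T / m)) := by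
    simp_rw [← Finset.sum_mul, hG.sum_biadj_right]
    simp
  have e5 : ∑ i, ∑ j, biadj G i j * ((s i - S / n) * (t j - T / m)) =
      ∑ i, ∑ j, biadj G i j * (s i * t j) - d₁ * S * (T / m) - d₂ * T * (S / n)
        + n * d₁ * (S / n * (T / m)) := by
    rw [← e2, ← e3, ← e4]
    simp only [← Finset.sum_sub_distrib, ← Finset.sum_add_distrib]
    exact Finset.sum_congr rfl fun i _ => Finset.sum_congr rfl fun j _ => by ring
  have hd₂ : (d₂ : ℝ) = n * d₁ / m := by field_simp; linarith
  rw [e1, e5, hd₂]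
  field_simp
  ring

/-- A form of the expander mixing lemma: the discrepancy matrix has small cut norm. -/
lemma IsBiregular.abs_sum_discrepancyMatrix_le (hG : IsBiregular G d₁ d₂) (h₁ : 0 < d₁)
    (h₂ : 0 < d₂) (hnm : 2 < n + m) {s : Fin n → ℝ} {t : Fin m → ℝ}
    (hs : ∀ i, s i = 1 ∨ s i = -1) (ht : ∀ j, t j = 1 ∨ t j = -1) :
    |∑ i, ∑ j, discrepancyMatrix G d₁ i j * (s i * t j)| ≤
      secondEigenvalue G / √((d₁ : ℝ) * d₂) := by
  have hn0 := hG.pos_left h₂ hnm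
  have hm0 := hG.pos_right h₁ hnm
  have hn : (0 : ℝ) < n := by exact_mod_cast hn0
  have hm : (0 : ℝ) < m := by exact_mod_cast hm0
  have hd₁ : (0 : ℝ) < d₁ := by positivity
  have hd₂ : (0 : ℝ) < d₂ := by positivity
  have hl := hG.secondEigenvalue_nonneg h₁ h₂ hnm
  have hE : (n : ℝ) * d₁ = √n * √m * √((d₁ : ℝ) * d₂) := by
    rw [← Real.sqrt_mul hn.le, ← Real.sqrt_mul (by positivity), eq_comm,
      Real.sqrt_eq_iff_mul_self_eq (by positivity) (by positivity)]
    linear_combination -(n * d₁ : ℝ) * hG.card_edges_eq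
  -- Up to the sign of `s`, an upper bound suffices.
  have key (s : Fin n → ℝ) (hs : ∀ i, s i = 1 ∨ s i = -1) :
      -∑ i, ∑ j, discrepancyMatrix G d₁ i j * (s i * t j) ≤
        secondEigenvalue G / √((d₁ : ℝ) * d₂) := by
    rw [hG.sum_discrepancyMatrix h₁ h₂ hnm, neg_div, neg_neg, hE,
      div_le_div_iff₀ (by positivity) (by positivity)]
    set p : Fin n → ℝ := fun i => s i - (∑ l, s l) / n with hp
    set q : Fin m → ℝ := fun j => t j - (∑ l, t l) / m with hq
    have hsp : ∑ i, p i = 0 := sum_sub_mean hn0 s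
    have hsq : ∑ j, q j = 0 := sum_sub_mean hm0 t
    have hp2 : ∑ i, p i ^ 2 ≤ n := sum_sub_mean_sq_le hn0 hs
    have hq2 : ∑ j, q j ^ 2 ≤ m := sum_sub_mean_sq_le hm0 ht
    -- The weights `1 / √n` and `1 / √m` make each part of the centred sign vector have squared norm
    -- at most `1`.
    have h := hG.sum_biadj_mul_le h₁ h₂ hnm (p := fun i => p i / √n) (q := fun j => q j / √m)
      (by rw [← Finset.sum_div, hsp, zero_div]) (by rw [← Finset.sum_div, hsq, zero_div])
    have hlhs : ∑ i, ∑ j, biadj G i j * (p i / √n * (q j / √m)) =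
        (∑ i, ∑ j, biadj G i j * (p i * q j)) / (√n * √m) := by
      simp_rw [Finset.sum_div]
      exact Finset.sum_congr rfl fun i _ => Finset.sum_congr rfl fun j _ => by ring
    simp_rw [div_pow, Real.sq_sqrt hn.le, Real.sq_sqrt hm.le, ← Finset.sum_div] at h
    rw [hlhs] at h
    have h1 : (∑ i, p i ^ 2) / n ≤ 1 := (div_le_one hn).2 hp2
    have h2 : (∑ j, q j ^ 2) / m ≤ 1 := (div_le_one hm).2 hq2
    have h3 : (∑ i, ∑ j, biadj G i j * (p i * q j)) / (√n * √m) ≤ secondEigenvalue G := by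
      nlinarith
    rw [div_le_iff₀ (by positivity)] at h3
    have := mul_le_mul_of_nonneg_right h3 (Real.sqrt_nonneg ((d₁ : ℝ) * d₂))
    linarith
  refine abs_le'.2 ⟨?_, key s hs⟩
  simpa using key (fun i => -s i) fun i => by rcases hs i with h | h <;> simp [h]

end Expander

/-! ### Factorizations and the completion error -/

section Factorization

variable {n m : ℕ}

lemma sum_sq_le_maxRowNorm_sq {k : ℕ} (U : Matrix (Fin n) (Fin k) ℝ) (i : Fin n) :
    ∑ j, U i j ^ 2 ≤ maxRowNorm U ^ 2 := by
  have h : √(∑ j, U i j ^ 2) ≤ maxRowNorm U :=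
    le_ciSup (f := fun i => √(∑ j, U i j ^ 2)) (Set.finite_range _).bddAbove i
  exact (Real.sqrt_le_iff.1 h).2

lemma maxRowNorm_nonneg {k : ℕ} (U : Matrix (Fin n) (Fin k) ℝ) : 0 ≤ maxRowNorm U :=
  Real.iSup_nonneg fun _ => Real.sqrt_nonneg _

lemma gammaTwo_nonneg (Y : Matrix (Fin n) (Fin m) ℝ) : 0 ≤ gammaTwo Y := by
  apply Real.sInf_nonneg
  rintro _ ⟨k, U, V, -, rfl⟩
  exact mul_nonneg (maxRowNorm_nonneg U) (maxRowNorm_nonneg V)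

/-- Rescaling the two factors against each other balances their row norms. -/
lemma exists_factorization_of_gammaTwo_lt {Y : Matrix (Fin n) (Fin m) ℝ} {c : ℝ}
    (hc : gammaTwo Y < c) :
    ∃ (k : ℕ) (U : Fin n → Fin k → ℝ) (V : Fin m → Fin k → ℝ),
      (∀ i j, Y i j = ∑ l, U i l * V j l) ∧
      (∀ i, ∑ l, U i l ^ 2 ≤ c) ∧ ∀ j, ∑ l, V j l ^ 2 ≤ c := by
  have hc0 : 0 < c := (gammaTwo_nonneg Y).trans_lt hc
  obtain ⟨_, ⟨k, U, V, hUV, rfl⟩, hlt⟩ := exists_lt_of_csInf_lt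
    (⟨_, m, Y, 1, by simp, rfl⟩ : Set.Nonempty {c : ℝ | ∃ (k : ℕ)
      (U : Matrix (Fin n) (Fin k) ℝ) (V : Matrix (Fin m) (Fin k) ℝ),
      U * V.transpose = Y ∧ c = maxRowNorm U * maxRowNorm V}) hc
  set a := maxRowNorm U
  set b := maxRowNorm V
  have ha : 0 ≤ a := maxRowNorm_nonneg U
  have hb : 0 ≤ b := maxRowNorm_nonneg V
  -- `U` is scaled by `√T` and `V` by `1 / √T`.
  obtain ⟨T, hT, hTa, hTb⟩ : ∃ T : ℝ, 0 < T ∧ T * a ^ 2 ≤ c ∧ b ^ 2 / T ≤ c := by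
    rcases ha.eq_or_lt with ha0 | ha0
    · refine ⟨(b ^ 2 + 1) / c, by positivity, by simp [← ha0, hc0.le], ?_⟩
      rw [div_div_eq_mul_div, div_le_iff₀ (by positivity)]
      nlinarith
    · refine ⟨c / a ^ 2, by positivity, by field_simp; rfl, ?_⟩
      rw [div_div_eq_mul_div, div_le_iff₀ hc0]
      nlinarith [mul_nonneg ha hb]
  have hsq : √T ^ 2 = T := Real.sq_sqrt hT.le
  have hT' : √T ≠ 0 := by positivity
  refine ⟨k, fun i l => √T * U i l, fun j l => V j l / √T, fun i j => ?_, fun i => ?_, fun j => ?_⟩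
  · rw [← hUV, Matrix.mul_apply]
    exact Finset.sum_congr rfl fun l _ => by rw [Matrix.transpose_apply]; field_simp
  · simp_rw [mul_pow, hsq, ← Finset.mul_sum]
    exact (mul_le_mul_of_nonneg_left (sum_sq_le_maxRowNorm_sq U i) hT.le).trans hTa
  · simp_rw [div_pow, hsq, ← Finset.sum_div]
    exact (div_le_div_of_nonneg_right (sum_sq_le_maxRowNorm_sq V j) hT.le).trans hTb

/-- Concatenation of factorizations of `X` and `Y` gives a factorization of `X - Y`. -/
lemma exists_factorization_sub {X Y : Matrix (Fin n) (Fin m) ℝ} {c : ℝ}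
    (hX : gammaTwo X < c) (hY : gammaTwo Y < c) :
    ∃ (κ : Type) (_ : Fintype κ) (P : Fin n → κ → ℝ) (Q : Fin m → κ → ℝ),
      (∀ i j, (X - Y) i j = ∑ l, P i l * Q j l) ∧
      (∀ i, ∑ l, P i l ^ 2 ≤ 2 * c) ∧ ∀ j, ∑ l, Q j l ^ 2 ≤ 2 * c := by
  obtain ⟨k₁, U₁, V₁, h₁, hU₁, hV₁⟩ := exists_factorization_of_gammaTwo_lt hX
  obtain ⟨k₂, U₂, V₂, h₂, hU₂, hV₂⟩ := exists_factorization_of_gammaTwo_lt hY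
  refine ⟨Fin k₁ ⊕ Fin k₂, inferInstance, fun i => Sum.elim (U₁ i) (-U₂ i),
    fun j => Sum.elim (V₁ j) (V₂ j), fun i j => ?_, fun i => ?_, fun j => ?_⟩
  · simp [h₁, h₂, sub_eq_add_neg]
  · simpa [two_mul] using add_le_add (hU₁ i) (hU₂ i)
  · simpa [two_mul] using add_le_add (hV₁ j) (hV₂ j)

lemma sum_tensor_mul_tensor {κ : Type*} [Fintype κ] (f g : κ → ℝ) :
    ∑ l : κ × κ, f l.1 * f l.2 * (g l.1 * g l.2) = (∑ l, f l * g l) ^ 2 := by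
  rw [pow_two, Finset.sum_mul_sum, Fintype.sum_prod_type]
  exact Finset.sum_congr rfl fun _ _ => Finset.sum_congr rfl fun _ _ => by ring

/-- The tensor squares of the rows of a factorization of `X - Y` factorize its entrywise square. -/
lemma exists_factorization_sub_sq {X Y : Matrix (Fin n) (Fin m) ℝ} {c : ℝ}
    (hX : gammaTwo X < c) (hY : gammaTwo Y < c) :
    ∃ (κ : Type) (_ : Fintype κ) (P : Fin n → κ → ℝ) (Q : Fin m → κ → ℝ),
      (∀ i j, (X - Y) i j ^ 2 = ∑ l, P i l * Q j l) ∧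
      (∀ i, ∑ l, P i l ^ 2 ≤ (2 * c) ^ 2) ∧ ∀ j, ∑ l, Q j l ^ 2 ≤ (2 * c) ^ 2 := by
  obtain ⟨κ, _, P, Q, hPQ, hP, hQ⟩ := exists_factorization_sub hX hY
  have hsq (f : κ → ℝ) (hf : ∑ l, f l ^ 2 ≤ 2 * c) :
      ∑ l : κ × κ, (f l.1 * f l.2) ^ 2 ≤ (2 * c) ^ 2 := by
    have h := sum_tensor_mul_tensor f f
    simp only [← pow_two] at h
    rw [h]
    exact pow_le_pow_left₀ (Finset.sum_nonneg fun _ _ => sq_nonneg _) hf 2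
  exact ⟨κ × κ, inferInstance, fun i l => P i l.1 * P i l.2, fun j l => Q j l.1 * Q j l.2,
    fun i j => by rw [hPQ, sum_tensor_mul_tensor], fun i => hsq _ (hP i), fun j => hsq _ (hQ j)⟩

/-- The homogeneous form of Grothendieck's inequality, for vectors with any finite index type. -/
lemma GrothendieckInequality.abs_sum_le {K : ℝ} (hK : GrothendieckInequality K)
    {M : Matrix (Fin n) (Fin m) ℝ} {B R : ℝ} (hB : 0 < B) (hR : 0 < R)
    (hM : ∀ (s : Fin n → ℝ) (t : Fin m → ℝ),
      (∀ i, s i = 1 ∨ s i = -1) → (∀ j, t j = 1 ∨ t j = -1) →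
        |∑ i, ∑ j, M i j * (s i * t j)| ≤ B)
    {κ : Type} [Fintype κ] {P : Fin n → κ → ℝ} {Q : Fin m → κ → ℝ}
    (hP : ∀ i, ∑ l, P i l ^ 2 ≤ R) (hQ : ∀ j, ∑ l, Q j l ^ 2 ≤ R) :
    |∑ i, ∑ j, M i j * ∑ l, P i l * Q j l| ≤ K * (B * R) := by
  let e := Fintype.equivFin κ
  have hsq : √R * √R = R := Real.mul_self_sqrt hR.le
  have hvec {f : κ → ℝ} (hf : ∑ l, f l ^ 2 ≤ R) :
      ‖(WithLp.toLp 2 fun l => f (e.symm l) / √R : EuclideanSpace ℝ _)‖ ≤ 1 := by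
    rw [EuclideanSpace.norm_eq, Real.sqrt_le_one]
    simp only [Real.norm_eq_abs, sq_abs, div_pow, Real.sq_sqrt hR.le]
    rw [e.symm.sum_comp fun l => f l ^ 2 / R, ← Finset.sum_div]
    exact (div_le_one hR).2 hf
  have h := hK n m _ (fun i j => M i j / B) (fun s t hs ht => ?_)
    (fun i => WithLp.toLp 2 fun l => P i (e.symm l) / √R)
    (fun j => WithLp.toLp 2 fun l => Q j (e.symm l) / √R) (fun i => hvec (hP i))
    (fun j => hvec (hQ j))
  · have heq : ∑ i, ∑ j, M i j / B * inner ℝ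
        (WithLp.toLp 2 fun l => P i (e.symm l) / √R : EuclideanSpace ℝ _)
        (WithLp.toLp 2 fun l => Q j (e.symm l) / √R) =
        (∑ i, ∑ j, M i j * ∑ l, P i l * Q j l) / (B * R) := by
      simp_rw [Finset.sum_div]
      refine Finset.sum_congr rfl fun i _ => Finset.sum_congr rfl fun j _ => ?_
      simp only [PiLp.inner_apply, RCLike.inner_apply, conj_trivial]
      rw [e.symm.sum_comp fun l => Q j l / √R * (P i l / √R)]
      have : ∑ l, Q j l / √R * (P i l / √R) = (∑ l, P i l * Q j l) / R := by
        rw [Finset.sum_div]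
        refine Finset.sum_congr rfl fun l _ => ?_
        rw [div_mul_div_comm, hsq, mul_comm]
      rw [this, div_mul_div_comm]
    rw [heq, abs_div, abs_of_pos (mul_pos hB hR), div_le_iff₀ (mul_pos hB hR)] at h
    exact h
  · have heq : ∑ i, ∑ j, M i j / B * (s i * t j) = (∑ i, ∑ j, M i j * (s i * t j)) / B := by
      simp_rw [Finset.sum_div]
      exact Finset.sum_congr rfl fun i _ => Finset.sum_congr rfl fun j _ => by ring
    rw [heq, abs_div, abs_of_pos hB]
    exact (div_le_one hB).2 (hM s t hs ht)

lemma frobenius_norm_sq (A : Matrix (Fin n) (Fin m) ℝ) : ‖A‖ ^ 2 = ∑ i, ∑ j, A i j ^ 2 := by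
  rw [Matrix.frobenius_norm_def, ← Real.sqrt_eq_rpow, Real.sq_sqrt (by positivity)]
  simp

end Factorization

open Filter Topology in
/-- The entrywise square of the error is factorized by vectors of squared norm close to
`(2 * gammaTwo Y) ^ 2`; Grothendieck's inequality for the discrepancy matrix bounds its sum. -/
theorem IsCompletion.norm_sub_sq_le {n m d₁ d₂ : ℕ} {G : SimpleGraph (Fin n ⊕ Fin m)}
    [DecidableRel G.Adj] (hG : IsBiregular G d₁ d₂) (h₁ : 0 < d₁) (h₂ : 0 < d₂)
    (hnm : 2 < n + m) {η : ℝ} (hη : secondEigenvalue G ≤ η) {Y X : Matrix (Fin n) (Fin m) ℝ}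
    (hX : IsCompletion G Y X) :
    1 / ((n : ℝ) * m) * ‖X - Y‖ ^ 2 ≤
      4 * grothendieckConstant * gammaTwo Y ^ 2 * (η / √((d₁ : ℝ) * d₂)) := by
  set β := η / √((d₁ : ℝ) * d₂)
  set γ := gammaTwo Y
  set K := grothendieckConstant
  have hXY : gammaTwo X ≤ γ := hX.2 Y fun _ _ _ => rfl
  have hβ' : secondEigenvalue G / √((d₁ : ℝ) * d₂) ≤ β :=
    div_le_div_of_nonneg_right hη (Real.sqrt_nonneg _)
  have hβ0 : 0 ≤ β :=
    (div_nonneg (hG.secondEigenvalue_nonneg h₁ h₂ hnm) (Real.sqrt_nonneg _)).trans hβ'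
  -- On the edges `X - Y` vanishes, so that only the uniform part of the discrepancy matrix counts.
  have hsum : 1 / ((n : ℝ) * m) * ‖X - Y‖ ^ 2 =
      ∑ i, ∑ j, discrepancyMatrix G d₁ i j * (X - Y) i j ^ 2 := by
    rw [frobenius_norm_sq, Finset.mul_sum]
    refine Finset.sum_congr rfl fun i _ => ?_
    rw [Finset.mul_sum]
    refine Finset.sum_congr rfl fun j _ => ?_
    unfold discrepancyMatrix biadj
    split_ifs with hadj
    · simp [hX.1 i j hadj]
    · simp
  have hbound (ε : ℝ) (hε : 0 < ε) :
      1 / ((n : ℝ) * m) * ‖X - Y‖ ^ 2 ≤ K * ((β + ε) * (2 * (γ + ε)) ^ 2) := by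
    have hγ0 : 0 ≤ γ := gammaTwo_nonneg Y
    obtain ⟨κ, _, P, Q, hPQ, hP, hQ⟩ := exists_factorization_sub_sq (X := X) (Y := Y)
      (c := γ + ε) (by linarith) (by linarith)
    have h := isLeast_grothendieckConstant.1.abs_sum_le (B := β + ε) (by linarith)
      (by positivity) (M := discrepancyMatrix G d₁) (fun s t hs ht =>
        (hG.abs_sum_discrepancyMatrix_le h₁ h₂ hnm hs ht).trans (by linarith)) hP hQ
    simp_rw [← hPQ, ← hsum] at h
    exact (le_abs_self _).trans h
  have hcont : Tendsto (fun ε : ℝ => K * ((β + ε) * (2 * (γ + ε)) ^ 2)) (𝓝[>] 0)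
      (𝓝 (K * ((β + 0) * (2 * (γ + 0)) ^ 2))) :=
    (Continuous.tendsto (by fun_prop) 0).mono_left nhdsWithin_le_nhds
  refine (ge_of_tendsto hcont (eventually_mem_nhdsWithin.mono hbound)).trans_eq ?_
  ring

end MatrixCompletion

theorem mainTheorem4 :
    IsLeast {K : ℝ | MatrixCompletion.GrothendieckInequality K}
      MatrixCompletion.grothendieckConstant ∧
    4 * MatrixCompletion.grothendieckConstant ≤ 7.13 ∧
    ∀ (n m d₁ d₂ : ℕ), 0 < d₁ → 0 < d₂ → 2 < n + m →
    ∀ (G : SimpleGraph (Fin n ⊕ Fin m)) [DecidableRel G.Adj],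
      MatrixCompletion.IsBiregular G d₁ d₂ →
    ∀ η : ℝ, MatrixCompletion.secondEigenvalue G ≤ η →
    ∀ Y Yhat : Matrix (Fin n) (Fin m) ℝ, MatrixCompletion.IsCompletion G Y Yhat →
      1 / ((n : ℝ) * (m : ℝ)) * ‖Yhat - Y‖ ^ 2 ≤
        4 * MatrixCompletion.grothendieckConstant * MatrixCompletion.gammaTwo Y ^ 2 *
          (η / Real.sqrt ((d₁ : ℝ) * (d₂ : ℝ))) :=
  ⟨MatrixCompletion.isLeast_grothendieckConstant,
    MatrixCompletion.four_mul_grothendieckConstant_le,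
    fun _ _ _ _ h₁ h₂ hnm _ _ hG _ hη _ _ hX => hX.norm_sub_sq_le hG h₁ h₂ hnm hη⟩
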